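/- Conventions. For a real normed space $Y$ with dual $Y^*$ and $s>1$, let $$J_s^Y(x)=\{x^*\in Y^*:\ \langle x^*,x\rangle=\|x\|\,\|x^*\|,\ \|x^*\|=\|x\|^{s-1}\}$$ be the duality map of $Y$. The space $Y$ is called \emph{$s$-smooth with constant $G>0$} if $$\|x-y\|^s\le\|x\|^s-s\,\langle j,y\rangle+G\,\|y\|^s\qquad\text{for all }x,y\in Y\text{ and all } j\in J_s^Y(x)$$ (the set $J_s^Y(x)$ is never empty, and the inequality forces it to consist of a single element $j_s^Y(x)$). It is called \emph{$s$-smooth} if this holds for some $G>0$. Lemma. Let $1<p<\infty$, $1<q<\infty$ and $0<T<\infty$, and let $X$ be a real Banach space that is $p$-smooth with constant $G_p^X$. Then the Lebesgue–Bochner space $L^q(0,T;X)$, with its standard norm $\|\vartheta\|=\bigl(\int_0^T\|\vartheta(t)\|_X^q\,\mathrm dt\bigr)^{1/q}$, is $\min(p,q)$-smooth. More precisely, let $K$ and $K'$ be the Lipschitz constants (that is, the smallest ones) of the functions $h\mapsto h^{q-p}$ and $h\mapsto h^{p-q}$, respectively, on $[\tfrac12,1]$. (i) If $q\le p$, then $L^q(0,T;X)$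 is $q$-smooth with constant $$2^{p-q}\max\bigl(2^p,\ G_p^X+K\,2^{p-2}\bigr).$$ (ii) If $p\le q$, then $L^q(0,T;X)$ is $p$-smooth with constant $$\max\bigl(2^q,\ 2^{q-p}G_p^X+K\,2^{q-2}\bigr)+K'\,2^{p-2}.$$ -/

import Mathlib

open MeasureTheory Set
open scoped NNReal ENNReal

/-- The duality map of a real normed space for the gauge `h ↦ h ^ (s - 1)`, as a set-valued map:
`J_s x = {f ∈ X* : f x = ‖x‖ ‖f‖ and ‖f‖ = ‖x‖ ^ (s - 1)}`. -/
def dualityMap {X : Type*} [NormedAddCommGroup X] [NormedSpace ℝ X] (s : ℝ) (x : X) :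
    Set (StrongDual ℝ X) :=
  {f | f x = ‖x‖ * ‖f‖ ∧ ‖f‖ = ‖x‖ ^ (s - 1)}

/-- The duality map has nonempty values (Hahn-Banach). -/
theorem dualityMap_nonempty {X : Type*} [NormedAddCommGroup X] [NormedSpace ℝ X] {s : ℝ}
    (hs : 1 < s) (x : X) : (dualityMap s x).Nonempty := by
  by_cases hx : x = 0
  · refine ⟨0, ?_, ?_⟩
    · simp
    · simp [hx, Real.zero_rpow (sub_ne_zero.2 hs.ne')]
  · obtain ⟨g, hg, hgx⟩ := exists_dual_vector ℝ x (norm_ne_zero_iff.2 hx)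
    have hn : ‖‖x‖ ^ (s - 1) • g‖ = ‖x‖ ^ (s - 1) := by
      rw [norm_smul, hg, mul_one, Real.norm_of_nonneg (Real.rpow_nonneg (norm_nonneg x) _)]
    refine ⟨‖x‖ ^ (s - 1) • g, ?_, hn⟩
    rw [hn]
    simp only [smul_apply, smul_eq_mul]
    rw [hgx]
    simp [mul_comm]

/-- `X` is smooth of power type `s` with constant `G`: for all `x, y`,
`‖x - y‖ ^ s ≤ ‖x‖ ^ s - s ⟨j_s x, y⟩ + G ‖y‖ ^ s`.
The inequality is required for every element `f` of `J_s x`.  For `1 < s` the set `J_s x` is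
nonempty, and the inequality forces it to be a singleton, so that `f` is the value `j_s x` of the
single-valued duality map. -/
def IsSmoothOfPowerTypeWith (X : Type*) [NormedAddCommGroup X] [NormedSpace ℝ X] (s G : ℝ) : Prop :=
  0 < G ∧ ∀ x : X, ∀ f ∈ dualityMap s x, ∀ y : X,
    ‖x - y‖ ^ s ≤ ‖x‖ ^ s - s * f y + G * ‖y‖ ^ s

/-- `X` is `s`-smooth (smooth of power type `s`). -/
def IsSmoothOfPowerType (X : Type*) [NormedAddCommGroup X] [NormedSpace ℝ X] (s : ℝ) : Prop :=
  ∃ G : ℝ, IsSmoothOfPowerTypeWith X s G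

/-- The (smallest) Lipschitz constant of `h ↦ h ^ a` on `[1/2, 1]`. -/
noncomputable def powLipschitzConst (a : ℝ) : ℝ≥0 :=
  sInf {L : ℝ≥0 | LipschitzOnWith L (fun h : ℝ => h ^ a) (Icc (1 / 2) 1)}

/-- The infimum defining `powLipschitzConst a` is over a nonempty set and is attained. -/
theorem powLipschitzConst_isLeast (a : ℝ) :
    IsLeast {L : ℝ≥0 | LipschitzOnWith L (fun h : ℝ => h ^ a) (Icc (1 / 2) 1)}
      (powLipschitzConst a) := by
  have hne : {L : ℝ≥0 | LipschitzOnWith L (fun h : ℝ => h ^ a) (Icc (1 / 2) 1)}.Nonempty := by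
    have hc : ContDiffOn ℝ 1 (fun h : ℝ => h ^ a) (Icc (1 / 2) 1) := fun x hx =>
      (Real.contDiffAt_rpow_const_of_ne (by linarith [hx.1] : x ≠ 0)).contDiffWithinAt
    exact hc.exists_lipschitzOnWith one_ne_zero (convex_Icc _ _) isCompact_Icc
  refine ⟨?_, fun L hL => csInf_le (OrderBot.bddBelow _) hL⟩
  refine IsClosed.csInf_mem ?_ hne (OrderBot.bddBelow _)
  simp only [lipschitzOnWith_iff_dist_le_mul, Set.ofPred_forall]
  refine isClosed_iInter fun x => isClosed_iInter fun _ => isClosed_iInter fun y =>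
    isClosed_iInter fun _ => isClosed_le continuous_const (by fun_prop)

/-- The Lebesgue-Bochner space `L^q(0,T;X)` with its standard norm. -/
abbrev LebesgueBochner (q T : ℝ) (X : Type*) [NormedAddCommGroup X] : Type _ :=
  Lp X (ENNReal.ofReal q) (volume.restrict (Ioo (0 : ℝ) T))

/-!
Fix a selection `j` of the duality map `J_p` of `X`; then `j_q(x) = ‖x‖ ^ (q - p) j(x)` lies in
`J_q(x)`. The proof establishes a pointwise inequality in `X` for the exponent `q`, integrates it,
and identifies the elements of the duality map of `L^q` without describing the dual of `L^q`.

*Pointwise inequality.* Scaling to `‖x‖ = 1` (`IsSmoothOfPowerTypeWith.rpow_norm_sub_le`) leaves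
scalar inequalities for `h = ‖x - y‖`, `k = ‖y‖` and `b = ⟨j x, y⟩`, where
`h ^ p ≤ 1 - p b + G k ^ p`. If `q ≤ p`, concavity of `t ↦ t ^ (q / p)` gives the inequality for
`k ≤ 2`, and for `k ≥ 2` the triangle inequality suffices
(`rpow_le_one_sub_mul_add_of_le`). If `p ≤ q`, the power `t ↦ t ^ (q / p)` is convex, and its
tangent at `1` is used with a remainder of order `q - p` (`rpow_remainder_le`). This remainder is
what the Lipschitz constants `K`, `K'` pay for: they are at least the derivatives of the powers at
`1 / 2` (`abs_mul_rpow_le_powLipschitzConst`). The outcome, `rpow_le_one_sub_mul_add_of_ge`,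
bounds the error by `C ((q - p) / p τ ^ p + τ ^ (p - q) k ^ q)` with a free parameter `τ`. For
`τ = ‖v‖ / ‖u‖` this integrates to `C (q / p) ‖u‖ ^ (q - p) ‖v‖ ^ p`, without any further loss,
and Bernoulli's inequality turns the resulting bound for `‖u - v‖ ^ q` into one for
`‖u - v‖ ^ p`. Large `v` are again covered by the triangle inequality.

*Duality map of `L^q`.* The integrated inequality bounds `‖u - v‖ ^ q` by
`‖u‖ ^ q - q ∫ ⟨j_q(u), v⟩` up to `O(‖v‖ ^ s)` with `s = min p q > 1`, whereas an element of `J_s(u)`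
is, up to a power of `‖u‖`, a subgradient of `‖·‖ ^ q` at `u`. Hence it agrees with
`v ↦ ∫ ⟨j_q(u), v⟩` (`rpow_norm_mul_apply_eq_of_mem_dualityMap`).

For `p ≤ q` the proof uses `p ≤ 2`, which holds unless `X` is trivial
(`IsSmoothOfPowerTypeWith.le_two`).
-/

/-! ### Scalar inequalities for powers -/

/-- The graph of `t ↦ t ^ q` lies above its tangent at `a`. -/
lemma rpow_add_mul_rpow_sub_one_le_rpow {q a b : ℝ} (hq : 1 ≤ q) (ha : 0 < a) (hb : 0 ≤ b) :
    a ^ q + q * a ^ (q - 1) * (b - a) ≤ b ^ q := by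
  have h := one_add_mul_self_le_rpow_one_add (s := b / a - 1)
    (by linarith [div_nonneg hb ha.le]) hq
  rw [add_sub_cancel, Real.div_rpow hb ha.le, le_div_iff₀ (by positivity)] at h
  rw [Real.rpow_sub_one ha.ne']
  calc _ = (1 + q * (b / a - 1)) * a ^ q := by field_simp
    _ ≤ _ := h

/-- Bernoulli's inequality for the power `q / p ≥ 1` of `h ^ p`. -/
lemma one_add_mul_rpow_sub_one_le_rpow {q p h : ℝ} (hp : 0 < p) (hpq : p ≤ q) (hh : 0 ≤ h) :
    1 + q / p * (h ^ p - 1) ≤ h ^ q := by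
  have := one_add_mul_self_le_rpow_one_add (s := h ^ p - 1)
    (by linarith [Real.rpow_nonneg hh p]) (p := q / p) ((one_le_div hp).2 hpq)
  rwa [add_sub_cancel, ← Real.rpow_mul hh, mul_div_cancel₀ _ hp.ne'] at this

/-- Bernoulli's inequality for the power `q / p ≤ 1` of `h ^ p`. -/
lemma rpow_le_one_add_mul_rpow_sub_one {q p h : ℝ} (hq : 0 < q) (hqp : q ≤ p) (hh : 0 ≤ h) :
    h ^ q ≤ 1 + q / p * (h ^ p - 1) := by
  have hp : 0 < p := hq.trans_le hqp
  have := rpow_one_add_le_one_add_mul_self (s := h ^ p - 1)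
    (by linarith [Real.rpow_nonneg hh p]) (p := q / p) (by positivity) ((div_le_one hp).2 hqp)
  rwa [add_sub_cancel, ← Real.rpow_mul hh, mul_div_cancel₀ _ hp.ne'] at this

/-- For perturbations at least twice as large as the base point the triangle inequality alone
gives smoothness of power type `q` with constant `2 ^ q`. -/
lemma one_add_rpow_add_mul_le_one_add_two_mul_rpow {q r : ℝ} (hq : 1 ≤ q) (hr : 2 ≤ r) :
    (1 + r) ^ q + q * r ≤ 1 + (2 * r) ^ q := by
  have h1 := rpow_add_mul_rpow_sub_one_le_rpow hq (a := 1 + r) (b := 2 * r)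
    (by linarith) (by linarith)
  -- `log (1 + r) ≥ log 3 ≥ 1`, so that `(1 + r) ^ (q - 1) ≥ 1 + (q - 1)`
  have h2 : q ≤ (1 + r) ^ (q - 1) := by
    have hlog : 1 ≤ Real.log (1 + r) :=
      (Real.le_log_iff_exp_le (by linarith)).2 (by linarith [Real.exp_one_lt_three])
    rw [Real.rpow_def_of_pos (by linarith)]
    nlinarith [Real.add_one_le_exp (Real.log (1 + r) * (q - 1))]
  have h3 : q * q * (r - 1) ≤ q * (1 + r) ^ (q - 1) * (2 * r - (1 + r)) := by
    have : 0 ≤ r - 1 := by linarith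
    rw [show 2 * r - (1 + r) = r - 1 by ring]
    gcongr
  nlinarith [mul_nonneg (mul_nonneg (by linarith : (0:ℝ) ≤ q) (by linarith : 0 ≤ q - 1))
    (by linarith : 0 ≤ r - 2)]

/-- The pointwise inequality behind the case `q ≤ p`, for a base point of norm `1`: here
`h = ‖x - y‖`, `k = ‖y‖` and `b = ⟨j x, y⟩`. -/
lemma rpow_le_one_sub_mul_add_of_le {p q G C h k b : ℝ} (hq : 1 < q) (hqp : q ≤ p) (hG : 0 ≤ G)
    (hC₁ : 2 ^ q ≤ C) (hC₂ : 2 ^ (p - q) * G ≤ C) (hh : 0 ≤ h) (hk : 0 ≤ k) (hhk : h ≤ 1 + k)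
    (hb : b ≤ k) (hs : h ^ p ≤ 1 - p * b + G * k ^ p) :
    h ^ q ≤ 1 - q * b + C * k ^ q := by
  have hp : 0 < p := by linarith
  rcases le_total k 2 with hk2 | hk2
  · have h1 := rpow_le_one_add_mul_rpow_sub_one (by linarith) hqp hh
    have h2 : k ^ p ≤ 2 ^ (p - q) * k ^ q := by
      calc k ^ p = k ^ (p - q) * k ^ q := by
            rw [← Real.rpow_add_of_nonneg hk (by linarith) (by linarith), sub_add_cancel]
        _ ≤ _ := by gcongr
    calc h ^ q ≤ 1 + q / p * (-(p * b) + G * k ^ p) := by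
          refine h1.trans ?_
          gcongr
          linarith
      _ = 1 - q * b + q / p * (G * k ^ p) := by field_simp; ring
      _ ≤ 1 - q * b + 1 * (G * k ^ p) := by
          gcongr
          exact (div_le_one hp).2 hqp
      _ ≤ 1 - q * b + 1 * (G * (2 ^ (p - q) * k ^ q)) := by gcongr
      _ = 1 - q * b + (2 ^ (p - q) * G) * k ^ q := by ring
      _ ≤ _ := by gcongr
  · have h1 := one_add_rpow_add_mul_le_one_add_two_mul_rpow hq.le hk2
    rw [Real.mul_rpow (by norm_num) hk] at h1
    have h2 : h ^ q ≤ (1 + k) ^ q := by gcongr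
    have h3 : 2 ^ q * k ^ q ≤ C * k ^ q := by gcongr
    nlinarith

/-- Exact form of the remainder in the tangent approximation `h ^ q ≈ 1 + (q / p) (h ^ p - 1)`. -/
lemma exists_rpow_remainder_eq {p q h : ℝ} (hp : 1 < p) (hpq : p ≤ q) (hh : 0 ≤ h) (h1 : h ≠ 1) :
    ∃ c, 0 < c ∧ min h 1 < c ∧ c < max h 1 ∧
      (h ^ q - 1 - q / p * (h ^ p - 1)) * (2 * (c - 1)) =
        (h - 1) ^ 2 * (q * c ^ (p - 1) * (c ^ (q - p) - 1)) := by
  have hcont : Continuous fun t : ℝ => t ^ q - 1 - q / p * (t ^ p - 1) := by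
    have h1 := Real.continuous_rpow_const (q := q) (by linarith)
    have h2 := Real.continuous_rpow_const (q := p) (by linarith)
    fun_prop
  have hderiv : ∀ t : ℝ, 0 < t → HasDerivAt (fun t : ℝ => t ^ q - 1 - q / p * (t ^ p - 1))
      (q * t ^ (p - 1) * (t ^ (q - p) - 1)) t := by
    intro t ht
    have := ((Real.hasDerivAt_rpow_const (x := t) (p := q) (Or.inl ht.ne')).sub_const 1).sub
      (((Real.hasDerivAt_rpow_const (x := t) (p := p) (Or.inl ht.ne')).sub_const 1).const_mul
        (q / p))
    refine this.congr_deriv ?_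
    have e : t ^ (q - 1) = t ^ (p - 1) * t ^ (q - p) := by
      rw [← Real.rpow_add ht]; congr 1; ring
    rw [e]
    field_simp
  have hsq : ∀ t : ℝ, HasDerivAt (fun t : ℝ => (t - 1) ^ 2) (2 * (t - 1)) t := fun t => by
    simpa using! ((hasDerivAt_id t).sub_const 1).pow 2
  rcases lt_or_gt_of_ne h1 with hlt | hgt
  · obtain ⟨c, hc, e⟩ := exists_ratio_hasDerivAt_eq_ratio_slope _ _ hlt hcont.continuousOn
      (fun t ht => hderiv t (hh.trans_lt ht.1)) _ _ (by fun_prop) (fun t _ => hsq t)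
    refine ⟨c, hh.trans_lt hc.1, by simpa [hlt.le] using hc.1, by simpa [hlt.le] using hc.2, ?_⟩
    simp only [Real.one_rpow] at e
    linarith
  · obtain ⟨c, hc, e⟩ := exists_ratio_hasDerivAt_eq_ratio_slope _ _ hgt hcont.continuousOn
      (fun t ht => hderiv t (zero_lt_one.trans ht.1)) _ _ (by fun_prop) (fun t _ => hsq t)
    refine ⟨c, zero_lt_one.trans hc.1, by simpa [hgt.le] using hc.1,
      by simpa [hgt.le] using hc.2, ?_⟩
    simp only [Real.one_rpow] at e
    linarith

/-- The remainder is of order `q - p`, relative to `|h - 1| ^ p`, on a bounded range: up to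
`|h - 1| ≤ 2` when `q - p ≤ 1`, and up to `|h - 1| ≤ 1` otherwise. -/
lemma rpow_remainder_le {p q h k : ℝ} (hp : 1 < p) (hp2 : p ≤ 2) (hpq : p ≤ q) (hh : 0 ≤ h)
    (hu : h ≤ 1 + k) (hl : 1 - k ≤ h) (hk : k ≤ 2 ∧ q - p ≤ 1 ∨ k ≤ 1 ∧ 1 ≤ q - p) :
    h ^ q - 1 - q / p * (h ^ p - 1) ≤
      q / p * ((q - p) * (2 ^ (p - 1) + 2 ^ (q - 1)) * k ^ p) := by
  have hk0 : 0 ≤ k := by linarith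
  have hp0 : 0 < p := by linarith
  have hq0 : 0 < q := by linarith
  have hε : 0 ≤ q - p := by linarith
  set D : ℝ := 2 ^ (p - 1) + 2 ^ (q - 1) with hD
  have hD2 : (2 : ℝ) ≤ D := by
    have h1 : (1 : ℝ) ≤ 2 ^ (p - 1) := Real.one_le_rpow (by norm_num) (by linarith)
    have h2 : (1 : ℝ) ≤ 2 ^ (q - 1) := Real.one_le_rpow (by norm_num) (by linarith)
    linarith
  have hDp : (2 : ℝ) ^ p ≤ D := by
    have h1 : (2 : ℝ) ^ (p - 1) ≤ 2 ^ (q - 1) := by gcongr; norm_num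
    have h2 : (2 : ℝ) ^ p = 2 * 2 ^ (p - 1) := by
      rw [Real.rpow_sub_one (by norm_num)]; ring
    linarith
  suffices H : h ^ q - 1 - q / p * (h ^ p - 1) ≤ q / p * ((q - p) * D * |h - 1| ^ p) by
    refine H.trans ?_
    have : |h - 1| ≤ k := abs_le.2 ⟨by linarith, by linarith⟩
    gcongr
  rcases eq_or_ne h 1 with rfl | h1
  · simp [Real.zero_rpow hp0.ne']
  -- it suffices to compare with the square, in the form in which the mean value theorem gives it
  have key : ∀ B, h ^ q - 1 - q / p * (h ^ p - 1) ≤ (h - 1) ^ 2 * (q * (q - p) * B / 2) →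
      p * B * |h - 1| ^ (2 - p) ≤ 2 * D →
      h ^ q - 1 - q / p * (h ^ p - 1) ≤ q / p * ((q - p) * D * |h - 1| ^ p) := by
    intro B hB hBD
    refine hB.trans ?_
    have e : (h - 1) ^ 2 = |h - 1| ^ (2 - p) * |h - 1| ^ p := by
      rw [← Real.rpow_add (abs_pos.2 (sub_ne_zero.2 h1)), ← sq_abs, ← Real.rpow_natCast]
      congr 1; push_cast; ring
    rw [e]
    calc _ = q / p * ((q - p) * (p * B * |h - 1| ^ (2 - p)) / 2 * |h - 1| ^ p) := by
          field_simp
      _ ≤ q / p * ((q - p) * (2 * D) / 2 * |h - 1| ^ p) := by gcongr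
      _ = _ := by ring
  obtain ⟨c, hc0, hc1, hc2, hc⟩ := exists_rpow_remainder_eq hp hpq hh h1
  rcases lt_or_gt_of_ne h1 with hlt | hgt
  · have hc1' : c < 1 := by simpa [hlt.le] using hc2
    have ha : |h - 1| ≤ 1 := abs_le.2 ⟨by linarith, by linarith⟩
    have ha' : |h - 1| ^ (2 - p) ≤ 1 := Real.rpow_le_one (abs_nonneg _) ha (by linarith)
    rcases le_total (q - p) 1 with hε1 | hε1
    -- `t ^ (q - p)` may have unbounded slope at `0`: Bernoulli's inequality for both powers
    -- replaces the mean value theorem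
    · refine key (2 * p / q) ?_ ?_
      · have e1 : h ^ (q - p) ≤ 1 + (q - p) * (h - 1) := by
          have := rpow_one_add_le_one_add_mul_self (s := h - 1) (by linarith) hε hε1
          rwa [add_sub_cancel] at this
        have e2 : 1 + p * (h - 1) ≤ h ^ p := by
          have := one_add_mul_self_le_rpow_one_add (s := h - 1) (by linarith) hp.le
          rwa [add_sub_cancel] at this
        have e3 : h ^ q = h ^ p * h ^ (q - p) := by
          rw [← Real.rpow_add_of_nonneg hh hp0.le hε]; congr 1; ring
        have e4 : h ^ q ≤ h ^ p * (1 + (q - p) * (h - 1)) := by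
          rw [e3]; gcongr
        have e5 : q / p * (h ^ p - 1) = (h ^ p - 1) + (q - p) / p * (h ^ p - 1) := by
          field_simp; ring
        have e6 : (q - p) / p * (p * (h - 1)) ≤ (q - p) / p * (h ^ p - 1) := by
          gcongr; linarith
        have e7 : (q - p) / p * (p * (h - 1)) = (q - p) * (h - 1) := by field_simp
        have e8 : (h - 1) ^ 2 * (q * (q - p) * (2 * p / q) / 2) = (q - p) * p * (h - 1) ^ 2 := by
          field_simp
        rw [e8]
        nlinarith [mul_nonneg hε (by linarith : 0 ≤ 1 - h)]
      · calc p * (2 * p / q) * |h - 1| ^ (2 - p) ≤ p * (2 * p / q) * 1 := by gcongr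
          _ = 2 * (p * p / q) := by ring
          _ ≤ 2 * (2 * q / q) := by gcongr
          _ ≤ 2 * D := by rw [mul_div_cancel_right₀ _ hq0.ne']; gcongr
    · refine key 1 ?_ (by nlinarith)
      have e1 : 1 + (q - p) * (c - 1) ≤ c ^ (q - p) := by
        have := one_add_mul_self_le_rpow_one_add (s := c - 1) (by linarith) hε1
        rwa [add_sub_cancel] at this
      have e2 : c ^ (p - 1) ≤ 1 := Real.rpow_le_one hc0.le hc1'.le (by linarith)
      have e3 : q * c ^ (p - 1) * (1 - c ^ (q - p)) ≤ q * 1 * ((q - p) * (1 - c)) := by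
        gcongr
        · have := Real.rpow_le_one hc0.le hc1'.le hε
          linarith
        · linarith
      refine le_of_mul_le_mul_right (?_ : _ * (2 * (1 - c)) ≤ _ * (2 * (1 - c))) (by linarith)
      nlinarith [mul_le_mul_of_nonneg_left e3 (sq_nonneg (h - 1))]
  · have hc1' : 1 < c := by simpa [hgt.le] using hc1
    have hch : c < h := by simpa [hgt.le] using hc2
    have ha : |h - 1| = h - 1 := abs_of_pos (by linarith)
    -- both cases reduce to a bound for `c ^ (p - 1) * (c ^ (q - p) - 1)`
    have key2 : ∀ B, c ^ (p - 1) * (c ^ (q - p) - 1) ≤ (q - p) * B * (c - 1) →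
        h ^ q - 1 - q / p * (h ^ p - 1) ≤ (h - 1) ^ 2 * (q * (q - p) * B / 2) := by
      intro B hB
      refine le_of_mul_le_mul_right (?_ : _ * (2 * (c - 1)) ≤ _ * (2 * (c - 1))) (by linarith)
      rw [hc]
      have := mul_le_mul_of_nonneg_left hB (mul_nonneg (sq_nonneg (h - 1)) hq0.le)
      linarith
    rcases hk with ⟨hk2, hε1⟩ | ⟨hk1, hε1⟩
    · refine key (3 ^ (p - 1)) (key2 _ ?_) ?_
      · have e1 : c ^ (q - p) ≤ 1 + (q - p) * (c - 1) := by
          have := rpow_one_add_le_one_add_mul_self (s := c - 1) (by linarith) hε hε1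
          rwa [add_sub_cancel] at this
        calc c ^ (p - 1) * (c ^ (q - p) - 1) ≤ 3 ^ (p - 1) * ((q - p) * (c - 1)) := by
              gcongr
              · have := Real.one_le_rpow hc1'.le hε
                linarith
              · linarith
              · linarith
          _ = _ := by ring
      · calc p * 3 ^ (p - 1) * |h - 1| ^ (2 - p) ≤ 2 * 4 ^ (p - 1) * 2 ^ (2 - p) := by
              gcongr
              · norm_num
              · rw [ha]; linarith
          _ = 2 * 2 ^ p := by
              rw [show (4 : ℝ) = 2 ^ (2 : ℝ) by norm_num, ← Real.rpow_mul (by norm_num), mul_assoc,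
                ← Real.rpow_add (by norm_num)]
              congr 2; ring
          _ ≤ 2 * D := by gcongr
    · refine key (2 ^ (q - 2)) (key2 _ ?_) ?_
      · have e1 : c ^ (q - p) - 1 ≤ (q - p) * c ^ (q - p - 1) * (c - 1) := by
          have := rpow_add_mul_rpow_sub_one_le_rpow hε1 hc0 (b := 1) zero_le_one
          rw [Real.one_rpow] at this
          linarith
        calc c ^ (p - 1) * (c ^ (q - p) - 1)
            ≤ c ^ (p - 1) * ((q - p) * c ^ (q - p - 1) * (c - 1)) := by gcongr
          _ = (q - p) * c ^ (q - 2) * (c - 1) := by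
              have : c ^ (q - 2) = c ^ (p - 1) * c ^ (q - p - 1) := by
                rw [← Real.rpow_add hc0]; congr 1; ring
              rw [this]; ring
          _ ≤ _ := by
              gcongr
              · linarith
              · linarith
      · have e1 : |h - 1| ^ (2 - p) ≤ 1 :=
          Real.rpow_le_one (abs_nonneg _) (by rw [ha]; linarith) (by linarith)
        calc p * 2 ^ (q - 2) * |h - 1| ^ (2 - p) ≤ 2 * 2 ^ (q - 2) * 1 := by gcongr
          _ = 2 ^ (q - 1) := by
            rw [show q - 2 = q - 1 - 1 by ring, Real.rpow_sub_one (by norm_num) (q - 1)]; ring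
          _ ≤ D := by rw [hD]; linarith [Real.rpow_pos_of_pos (zero_lt_two' ℝ) (p - 1)]
          _ ≤ _ := by linarith

/-- Young's inequality with weights `(q - p) / q` and `p / q`; it is an equality for `τ = k`. -/
lemma mul_rpow_le_weighted_sum {p q k τ : ℝ} (hp : 0 < p) (hpq : p ≤ q) (hk : 0 ≤ k) (hτ : 0 < τ) :
    q / p * k ^ p ≤ (q - p) / p * τ ^ p + τ ^ (p - q) * k ^ q := by
  have h := one_add_mul_rpow_sub_one_le_rpow hp hpq (div_nonneg hk hτ.le)
  rw [Real.div_rpow hk hτ.le, Real.div_rpow hk hτ.le] at h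
  have h2 := mul_le_mul_of_nonneg_left h (Real.rpow_nonneg hτ.le p)
  rw [Real.rpow_sub hτ]
  have hτp := Real.rpow_pos_of_pos hτ p
  have hτq := Real.rpow_pos_of_pos hτ q
  have e1 : τ ^ p * (1 + q / p * (k ^ p / τ ^ p - 1)) = q / p * k ^ p - (q - p) / p * τ ^ p := by
    field_simp; ring
  have e2 : τ ^ p * (k ^ q / τ ^ q) = τ ^ p / τ ^ q * k ^ q := by ring
  rw [e1, e2] at h2
  linarith

/-- As a function of `τ`, the weighted sum decreases up to `τ = k`. -/
lemma weighted_sum_anti {p q k τ R : ℝ} (hp : 0 < p) (hpq : p ≤ q) (hτ : 0 < τ) (hτR : τ ≤ R)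
    (hRk : R ≤ k) :
    (q - p) / p * R ^ p + R ^ (p - q) * k ^ q ≤ (q - p) / p * τ ^ p + τ ^ (p - q) * k ^ q := by
  have hR : 0 < R := hτ.trans_le hτR
  have h1 := mul_rpow_le_weighted_sum hp hpq hR.le hτ
  have h2 : R ^ (p - q) ≤ τ ^ (p - q) := Real.rpow_le_rpow_of_nonpos hτ hτR (by linarith)
  have h3 : R ^ q ≤ k ^ q := by gcongr; linarith
  have h4 : R ^ (p - q) * R ^ q = R ^ p := by rw [← Real.rpow_add hR, sub_add_cancel]
  have h5 : (q - p) / p * R ^ p + R ^ p = q / p * R ^ p := by field_simp; ring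
  nlinarith [mul_le_mul h2 (le_refl (k ^ q - R ^ q)) (by linarith) (Real.rpow_nonneg hτ.le _)]

/-- The triangle inequality estimate for `k ≥ 2` in the case `q - p ≤ 1`. -/
lemma one_add_rpow_add_mul_le_of_two_le {p q k : ℝ} (hp : 1 < p) (hp2 : p ≤ 2) (hpq : p ≤ q)
    (hε : q - p ≤ 1) (hk : 2 ≤ k) :
    (1 + k) ^ q + q * k ≤
      1 + 2 ^ p * (1 + (q - p) / 2) * ((q - p) / p * 2 ^ q + k ^ q) := by
  have hq : 1 < q := by linarith
  set B : ℝ := 2 ^ p * (1 + (q - p) / 2) with hB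
  have hB2 : 2 ^ p ≤ B := le_mul_of_one_le_right (by positivity) (by linarith)
  -- this compares the derivatives, since `1 + k ≤ 1.5 k` and `1 ≤ 2⁻¹ k` for `k ≥ 2`
  have hslope : 1.5 ^ (q - 1) + 2⁻¹ ^ (q - 1) ≤ B := by
    rcases le_total (q - 1) 1 with h1 | h1
    · have e1 := rpow_one_add_le_one_add_mul_self (s := 1 / 2) (by norm_num) (p := q - 1)
        (by linarith) h1
      have e2 := rpow_one_add_le_one_add_mul_self (s := - 1 / 2) (by norm_num) (p := q - 1)
        (by linarith) h1
      norm_num at e1 e2 ⊢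
      have e3 : (2 : ℝ) ^ (1 : ℝ) ≤ 2 ^ p := by gcongr; norm_num
      rw [Real.rpow_one] at e3
      linarith
    · have e1 : (2 : ℝ) ^ (q - 1) ≤ 2 ^ p := by
        gcongr
        · norm_num
        · linarith
      have e2 : (3 / 2 : ℝ) ^ (q - 1) ≥ (3 / 2) ^ (1 : ℝ) := by gcongr; norm_num
      have e3 : (4 / 3 : ℝ) ^ (q - 1) ≥ (4 / 3) ^ (1 : ℝ) := by gcongr; norm_num
      have e4 : (2⁻¹ : ℝ) ^ (q - 1) ≤ 2⁻¹ ^ (1 : ℝ) :=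
        Real.rpow_le_rpow_of_exponent_ge (by norm_num) (by norm_num) h1
      have e5 : (2 : ℝ) ^ (q - 1) = (3 / 2) ^ (q - 1) * (4 / 3) ^ (q - 1) := by
        rw [← Real.mul_rpow (by norm_num) (by norm_num)]; norm_num
      rw [Real.rpow_one] at e2 e3 e4
      norm_num at e2 e3 e4 e5 ⊢
      nlinarith
  -- the difference of the two sides increases on `[2, ∞)`
  let F : ℝ → ℝ := fun t => B * t ^ q - (1 + t) ^ q - q * t
  have hderiv : ∀ t, 0 < t → HasDerivAt F
      (B * (q * t ^ (q - 1)) - q * (1 + t) ^ (q - 1) - q) t := by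
    intro t ht
    have h1 := (Real.hasDerivAt_rpow_const (x := t) (p := q) (Or.inl ht.ne')).const_mul B
    have h2 := ((hasDerivAt_id t).const_add 1).rpow_const (p := q)
      (Or.inl (by simp only [id]; linarith))
    have h3 := (hasDerivAt_id t).const_mul q
    refine ((h1.sub h2).sub h3).congr_deriv ?_
    simp
  have hmono : MonotoneOn F (Ici 2) := by
    refine monotoneOn_of_deriv_nonneg (convex_Ici 2)
      (fun t ht => (hderiv t (by linarith [mem_Ici.1 ht])).continuousAt.continuousWithinAt)
      (fun t ht => ?_) (fun t ht => ?_)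
    · rw [interior_Ici] at ht
      exact (hderiv t (by linarith [mem_Ioi.1 ht])).differentiableAt.differentiableWithinAt
    · rw [interior_Ici, mem_Ioi] at ht
      rw [(hderiv t (by linarith)).deriv]
      have e1 : (1 + t) ^ (q - 1) ≤ 1.5 ^ (q - 1) * t ^ (q - 1) := by
        rw [← Real.mul_rpow (by norm_num) (by linarith)]
        gcongr
        linarith
      have e2 : 1 ≤ 2⁻¹ ^ (q - 1) * t ^ (q - 1) := by
        rw [← Real.mul_rpow (by norm_num) (by linarith)]
        exact Real.one_le_rpow (by linarith) (by linarith)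
      have e3 := mul_le_mul_of_nonneg_right hslope
        (Real.rpow_nonneg (by linarith : (0 : ℝ) ≤ t) (q - 1))
      nlinarith
  have h2 : F 2 ≤ F k := hmono self_mem_Ici hk hk
  -- the value at `2`
  have hS := one_add_rpow_add_mul_le_one_add_two_mul_rpow hq.le (le_refl 2)
  have hpow : (2 : ℝ) ^ (q - p) ≤ 1 + (q - p) := by
    have := rpow_one_add_le_one_add_mul_self (s := 1) (by norm_num) (p := q - p) (by linarith) hε
    norm_num at this
    linarith
  have hm : (q - p) / 2 ≤ (q - p) / p := by gcongr
  have hB' : 2 ^ q ≤ B * (1 + (q - p) / p) := by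
    have e : (2 : ℝ) ^ q = 2 ^ p * 2 ^ (q - p) := by
      rw [← Real.rpow_add (by norm_num), add_sub_cancel]
    rw [e, hB, mul_assoc]
    gcongr
    nlinarith
  have h4 : (2 * 2 : ℝ) ^ q ≤ B * (1 + (q - p) / p) * 2 ^ q := by
    rw [Real.mul_rpow (by norm_num) (by norm_num)]
    gcongr
  norm_num [F] at h2 hS h4
  nlinarith

/-- The triangle inequality estimate for `k ≥ 1` in the case `1 ≤ q - p`. -/
lemma one_add_rpow_add_mul_le_of_one_le {p q C k : ℝ} (hp : 1 < p) (hp2 : p ≤ 2)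
    (hε : 1 ≤ q - p) (hk : 1 ≤ k) (hC : 2 ^ q + (q - p) * 2 ^ (q - 1) ≤ C) :
    (1 + k) ^ q + q * k ≤ 1 + C * ((q - p) / p + k ^ q) := by
  have h1 : (1 + k) ^ q ≤ 2 ^ q * k ^ q := by
    rw [← Real.mul_rpow (by norm_num) (by linarith)]
    gcongr <;> linarith
  have h2 : (2 : ℝ) ≤ 2 ^ (q - 1) := by
    have := Real.rpow_le_rpow_of_exponent_le (x := 2) (by norm_num) (show 1 ≤ q - 1 by linarith)
    rwa [Real.rpow_one] at this
  have h3 : (2 : ℝ) ^ q = 2 * 2 ^ (q - 1) := by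
    rw [Real.rpow_sub_one (by norm_num)]; ring
  have h4 : k ^ 2 ≤ k ^ q := by
    rw [← Real.rpow_natCast]
    exact Real.rpow_le_rpow_of_exponent_le hk (by push_cast; linarith)
  have h5 : (q - p) * 2 * k ^ 2 ≤ (q - p) * 2 ^ (q - 1) * k ^ q := by gcongr
  have hC4 : 4 ≤ C := by nlinarith
  have h6 : 4 * ((q - p) / 2) ≤ C * ((q - p) / p) := by
    gcongr
  have h7 : (2 ^ q + (q - p) * 2 ^ (q - 1)) * k ^ q ≤ C * k ^ q := by gcongr
  nlinarith [mul_nonneg (by linarith : 0 ≤ q - p) (sq_nonneg (k - 1))]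

/-- The pointwise inequality behind the case `p ≤ q`, for a base point of norm `1`: here
`h = ‖x - y‖`, `k = ‖y‖` and `b = ⟨j x, y⟩`.  The free parameter `τ` will be the ratio of the
norms in the Lebesgue-Bochner space, for which the last term integrates to a multiple of the
`p`-th power of the norm of the perturbation. -/
lemma rpow_le_one_sub_mul_add_of_ge {p q G C R τ h k b : ℝ} (hp : 1 < p) (hp2 : p ≤ 2)
    (hpq : p ≤ q) (hR : R = 2 ∧ q - p ≤ 1 ∨ R = 1 ∧ 1 ≤ q - p)
    (hC₁ : 2 ^ q + (q - p) * 2 ^ (q - 1) ≤ C)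
    (hC₂ : G + (q - p) * (2 ^ (p - 1) + 2 ^ (q - 1)) ≤ C) (hτ : 0 < τ) (hτR : τ ≤ R)
    (hh : 0 ≤ h) (hk : 0 ≤ k) (hu : h ≤ 1 + k) (hl : 1 - k ≤ h) (hb : b ≤ k)
    (hs : h ^ p ≤ 1 - p * b + G * k ^ p) :
    h ^ q ≤ 1 - q * b + C * ((q - p) / p * τ ^ p + τ ^ (p - q) * k ^ q) := by
  have hp0 : 0 < p := by linarith
  have hq0 : 0 < q := by linarith
  have hC0 : 0 ≤ C := by
    have h1 : (0 : ℝ) ≤ (q - p) * 2 ^ (q - 1) := mul_nonneg (by linarith) (by positivity)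
    have h2 : (0 : ℝ) ≤ 2 ^ q := by positivity
    linarith
  rcases le_total k R with hkR | hkR
  · have h1 := rpow_remainder_le hp hp2 hpq hh hu hl
      (by rcases hR with ⟨rfl, h⟩ | ⟨rfl, h⟩ <;> simp [hkR, h])
    have h2 := mul_rpow_le_weighted_sum hp0 hpq hk hτ
    have h3 : q / p * (h ^ p - 1) ≤ q / p * (-(p * b) + G * k ^ p) := by
      gcongr
      linarith
    calc h ^ q ≤ 1 + q / p * (-(p * b) + G * k ^ p)
          + q / p * ((q - p) * (2 ^ (p - 1) + 2 ^ (q - 1)) * k ^ p) := by linarith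
      _ = 1 - q * b + (G + (q - p) * (2 ^ (p - 1) + 2 ^ (q - 1))) * (q / p * k ^ p) := by
          field_simp; ring
      _ ≤ 1 - q * b + C * (q / p * k ^ p) := by gcongr
      _ ≤ _ := by gcongr
  · have h1 := weighted_sum_anti hp0 hpq hτ hτR hkR
    have h2 : h ^ q ≤ (1 + k) ^ q := by gcongr
    have h3 : q * b ≤ q * k := by gcongr
    have h4 := mul_le_mul_of_nonneg_left h1 hC0
    suffices (1 + k) ^ q + q * k ≤ 1 + C * ((q - p) / p * R ^ p + R ^ (p - q) * k ^ q) by linarith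
    rcases hR with ⟨rfl, hε⟩ | ⟨rfl, hε⟩
    · refine (one_add_rpow_add_mul_le_of_two_le hp hp2 hpq hε hkR).trans ?_
      have e1 : (2 : ℝ) ^ p = 2 ^ q * 2 ^ (p - q) := by
        rw [← Real.rpow_add (by norm_num), add_sub_cancel]
      have e2 : (2 : ℝ) ^ q * (1 + (q - p) / 2) ≤ C := by
        rw [Real.rpow_sub_one (by norm_num)] at hC₁
        linarith
      have e3 : 0 ≤ (q - p) / p := div_nonneg (by linarith) hp0.le
      have e4 : (2 : ℝ) ^ (p - q) * ((q - p) / p * 2 ^ q + k ^ q) =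
          (q - p) / p * 2 ^ p + 2 ^ (p - q) * k ^ q := by rw [e1]; ring
      rw [← e4]
      calc _ = 1 + 2 ^ q * (1 + (q - p) / 2) *
            (2 ^ (p - q) * ((q - p) / p * 2 ^ q + k ^ q)) := by rw [e1]; ring
        _ ≤ _ := by gcongr
    · simpa using one_add_rpow_add_mul_le_of_one_le hp hp2 hε hkR hC₁

/-- The triangle inequality estimate in the Lebesgue-Bochner space for the case `p ≤ q`. -/
lemma one_add_rpow_add_mul_le_one_add_mul_rpow {p q C R r : ℝ} (hp : 1 < p) (hp2 : p ≤ 2)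
    (hpq : p ≤ q) (hR : R = 2 ∧ q - p ≤ 1 ∨ R = 1 ∧ 1 ≤ q - p) (hC : 2 ^ q ≤ C) (hr : R ≤ r) :
    (1 + r) ^ p + p * r ≤ 1 + C * r ^ p := by
  rcases hR with ⟨rfl, hε⟩ | ⟨rfl, hε⟩
  · have h := one_add_rpow_add_mul_le_one_add_two_mul_rpow hp.le hr
    rw [Real.mul_rpow (by norm_num) (by linarith)] at h
    have : (2 : ℝ) ^ p * r ^ p ≤ C * r ^ p := by
      refine mul_le_mul_of_nonneg_right (le_trans ?_ hC) (Real.rpow_nonneg (by linarith) _)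
      gcongr
      norm_num
    linarith
  · have h1 : (1 + r) ^ p ≤ 2 ^ p * r ^ p := by
      rw [← Real.mul_rpow (by norm_num) (by linarith)]
      gcongr
      linarith
    have h2 : r ≤ r ^ p := Real.self_le_rpow_of_one_le hr hp.le
    have h3 : (2 : ℝ) ≤ 2 ^ p := Real.self_le_rpow_of_one_le (by norm_num) hp.le
    have h4 : (2 : ℝ) ^ (p + 1) ≤ 2 ^ q := by
      gcongr
      · norm_num
      · linarith
    rw [Real.rpow_add_one (by norm_num)] at h4
    have h5 : (2 ^ p + 2) * r ^ p ≤ C * r ^ p := by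
      gcongr
      linarith
    have h6 : p * r ≤ 2 * r ^ p := by gcongr
    linarith

/-! ### The Lipschitz constant of a power function -/

/-- The Lipschitz constant is at least the absolute value of the derivative at `1 / 2`. -/
lemma abs_mul_rpow_le_powLipschitzConst (a : ℝ) :
    |a| * (1 / 2) ^ (a - 1) ≤ (powLipschitzConst a : ℝ) := by
  have hlip : LipschitzOnWith (powLipschitzConst a) (fun h : ℝ => h ^ a) (Icc (1 / 2) 1) :=
    (powLipschitzConst_isLeast a).1
  have hcont : ContinuousAt (fun x : ℝ => |a| * x ^ (a - 1)) (1 / 2) :=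
    (Real.continuousAt_rpow_const _ _ (Or.inl (by norm_num))).const_mul _
  refine ContinuousWithinAt.closure_le (s := Ioo (1 / 2 : ℝ) 1) (f := fun x => |a| * x ^ (a - 1))
    (g := fun _ => (powLipschitzConst a : ℝ)) ?_ hcont.continuousWithinAt
    continuousWithinAt_const fun x hx => ?_
  · rw [closure_Ioo (by norm_num)]
    exact left_mem_Icc.2 (by norm_num)
  · have hx0 : 0 < x := by linarith [hx.1]
    have := (Real.hasDerivAt_rpow_const (x := x) (p := a) (Or.inl hx0.ne')).le_of_lipschitzOn
      (Icc_mem_nhds hx.1 hx.2) hlip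
    rwa [norm_mul, Real.norm_eq_abs, Real.norm_of_nonneg (Real.rpow_nonneg hx0.le _)] at this

/-! ### Duality maps and smoothness in a normed space -/

section NormedSpace

variable {X : Type*} [NormedAddCommGroup X] [NormedSpace ℝ X]

lemma apply_self_of_mem_dualityMap {s : ℝ} (hs : 1 < s) {x : X} {f : StrongDual ℝ X}
    (hf : f ∈ dualityMap s x) : f x = ‖x‖ ^ s := by
  rw [hf.1, hf.2]
  rcases eq_or_ne x 0 with rfl | hx
  · simp [Real.zero_rpow (by linarith : s ≠ 0)]
  · rw [Real.rpow_sub_one (norm_ne_zero_iff.2 hx)]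
    field_simp [norm_ne_zero_iff.2 hx]

lemma eq_zero_of_mem_dualityMap_zero {s : ℝ} (hs : 1 < s) {f : StrongDual ℝ X}
    (hf : f ∈ dualityMap s (0 : X)) : f = 0 := by
  rw [← norm_eq_zero, hf.2, norm_zero, Real.zero_rpow (by linarith)]

lemma apply_le_of_mem_dualityMap {s : ℝ} {x : X} {f : StrongDual ℝ X}
    (hf : f ∈ dualityMap s x) (y : X) : f y ≤ ‖x‖ ^ (s - 1) * ‖y‖ :=
  hf.2 ▸ (le_abs_self _).trans (f.le_opNorm y)

/-- Elements of the duality map give subgradients of `‖·‖ ^ q`; the exponent `q` need not be the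
exponent `s` of the duality map. -/
lemma rpow_norm_sub_mul_le_rpow_norm_sub {s q : ℝ} (hs : 1 < s) (hq : 1 ≤ q) {x : X}
    {f : StrongDual ℝ X} (hf : f ∈ dualityMap s x) (y : X) :
    ‖x‖ ^ q - q * (‖x‖ ^ (q - s) * f y) ≤ ‖x - y‖ ^ q := by
  rcases eq_or_ne x 0 with rfl | hx
  · rw [eq_zero_of_mem_dualityMap_zero hs hf, norm_zero, Real.zero_rpow (by linarith)]
    simp
    positivity
  · have hx0 : 0 < ‖x‖ := norm_pos_iff.2 hx
    have h1 := rpow_add_mul_rpow_sub_one_le_rpow hq hx0 (norm_nonneg (x - y))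
    have h2 := apply_le_of_mem_dualityMap hf (x - y)
    rw [map_sub, apply_self_of_mem_dualityMap hs hf] at h2
    have e1 : ‖x‖ ^ s = ‖x‖ ^ (s - 1) * ‖x‖ := by
      rw [← Real.rpow_add_one hx0.ne', sub_add_cancel]
    have e2 : ‖x‖ ^ (q - 1) = ‖x‖ ^ (q - s) * ‖x‖ ^ (s - 1) := by
      rw [← Real.rpow_add hx0]; congr 1; ring
    have h3 := mul_le_mul_of_nonneg_left h2
      (mul_nonneg (by linarith : 0 ≤ q) (Real.rpow_nonneg hx0.le (q - s)))
    rw [e1] at h3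
    rw [e2] at h1
    linarith

/-- A nontrivial space has no smoothness of power type better than `2`. -/
lemma IsSmoothOfPowerTypeWith.le_two [Nontrivial X] {p G : ℝ} (hp : 1 < p)
    (hX : IsSmoothOfPowerTypeWith X p G) : p ≤ 2 := by
  by_contra! h2
  obtain ⟨x, hx⟩ := exists_norm_eq X zero_le_one
  obtain ⟨f, hf⟩ := dualityMap_nonempty hp x
  have hfx : f x = 1 := by rw [apply_self_of_mem_dualityMap hp hf, hx, Real.one_rpow]
  -- adding the smoothness inequalities for the perturbations `t • x` and `-t • x`
  have key : ∀ t ∈ Ioc (0 : ℝ) 1, p ≤ 2 * G * t ^ (p - 2) := by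
    intro t ht
    have ineq : ∀ c : ℝ, c ≤ 1 → (1 - c) ^ p ≤ 1 - p * c + G * |c| ^ p := by
      intro c hc
      have h := hX.2 x f hf (c • x)
      have e : x - c • x = (1 - c) • x := by rw [sub_smul, one_smul]
      rwa [e, norm_smul, norm_smul, map_smul, hfx, hx, Real.one_rpow, mul_one, mul_one,
        smul_eq_mul, mul_one, Real.norm_of_nonneg (by linarith), Real.norm_eq_abs] at h
    -- Bernoulli's inequality for the power `p / 2 > 1` of `(1 - c) ^ 2`
    have low : ∀ c : ℝ, c ≤ 1 → 1 + p / 2 * (c ^ 2 - 2 * c) ≤ (1 - c) ^ p := by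
      intro c hc
      have h := one_add_mul_self_le_rpow_one_add (s := c ^ 2 - 2 * c)
        (by nlinarith [sq_nonneg (c - 1)]) (p := p / 2) (by linarith)
      rwa [show 1 + (c ^ 2 - 2 * c) = (1 - c) ^ (2 : ℝ) by rw [Real.rpow_two]; ring,
        ← Real.rpow_mul (by linarith), mul_div_cancel₀ _ two_ne_zero] at h
    have h1 := (low t ht.2).trans (ineq t ht.2)
    have h3 := (low (-t) (by linarith [ht.1])).trans (ineq (-t) (by linarith [ht.1]))
    rw [abs_neg] at h3
    rw [abs_of_pos ht.1] at h1 h3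
    have e : t ^ p = t ^ (p - 2) * t ^ 2 := by
      rw [← Real.rpow_natCast, ← Real.rpow_add ht.1]; congr 1; push_cast; ring
    rw [e] at h1 h3
    refine le_of_mul_le_mul_right ?_ (pow_pos ht.1 2)
    linarith
  have hlim : Filter.Tendsto (fun t : ℝ => 2 * G * t ^ (p - 2)) (nhdsWithin 0 (Ioi 0))
      (nhds (2 * G * 0 ^ (p - 2))) :=
    (((Real.continuousAt_rpow_const 0 (p - 2) (Or.inr (by linarith))).const_mul
      (2 * G)).tendsto).mono_left nhdsWithin_le_nhds
  rw [Real.zero_rpow (by linarith), mul_zero] at hlim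
  have := ge_of_tendsto hlim (Filter.mem_of_superset (Ioc_mem_nhdsGT one_pos) key)
  linarith

/-- Scaling reduces an inequality for `‖x - y‖ ^ q` to a scalar one for `‖x‖ = 1`. -/
lemma IsSmoothOfPowerTypeWith.rpow_norm_sub_le {p q G W₁ W₂ : ℝ} (hp : 1 < p) (hq : 0 < q)
    (hX : IsSmoothOfPowerTypeWith X p G) (hW₂ : 1 ≤ W₂)
    (H : ∀ h k b : ℝ, 0 ≤ h → 0 ≤ k → h ≤ 1 + k → 1 - k ≤ h → b ≤ k →
      h ^ p ≤ 1 - p * b + G * k ^ p → h ^ q ≤ 1 - q * b + (W₁ + W₂ * k ^ q))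
    (x y : X) {f : StrongDual ℝ X} (hf : f ∈ dualityMap p x) :
    ‖x - y‖ ^ q ≤ ‖x‖ ^ q - q * (‖x‖ ^ (q - p) * f y) + (W₁ * ‖x‖ ^ q + W₂ * ‖y‖ ^ q) := by
  rcases eq_or_ne x 0 with rfl | hx
  · rw [eq_zero_of_mem_dualityMap_zero hp hf, norm_zero, Real.zero_rpow hq.ne', zero_sub, norm_neg]
    simpa using le_mul_of_one_le_left (Real.rpow_nonneg (norm_nonneg y) q) hW₂
  · have hx0 : 0 < ‖x‖ := norm_pos_iff.2 hx
    have hxp := Real.rpow_pos_of_pos hx0 p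
    have hxq := Real.rpow_pos_of_pos hx0 q
    have h1 : ‖x - y‖ ≤ ‖x‖ + ‖y‖ := norm_sub_le x y
    have h2 : ‖x‖ - ‖y‖ ≤ ‖x - y‖ := norm_sub_norm_le x y
    have h3 := apply_le_of_mem_dualityMap hf y
    have h4 := hX.2 x f hf y
    have key := H (‖x - y‖ / ‖x‖) (‖y‖ / ‖x‖) (f y / ‖x‖ ^ p) (by positivity) (by positivity)
      (by rw [div_le_iff₀ hx0]; field_simp; exact h1)
      (by rw [le_div_iff₀ hx0]; field_simp; exact h2)
      (by
        rw [Real.rpow_sub_one hx0.ne'] at h3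
        rw [div_le_iff₀ hxp]
        exact h3.trans_eq (by ring))
      (by
        rw [Real.div_rpow (norm_nonneg _) hx0.le, Real.div_rpow (norm_nonneg _) hx0.le,
          div_le_iff₀ hxp]
        refine h4.trans_eq ?_
        field_simp)
    rw [Real.div_rpow (norm_nonneg _) hx0.le, Real.div_rpow (norm_nonneg _) hx0.le,
      div_le_iff₀ hxq] at key
    refine key.trans_eq ?_
    rw [Real.rpow_sub hx0]
    field_simp

/-- If `‖·‖ ^ q` is differentiable at `x` in direction `y` with derivative `q A(y)`, expressed by a
one-sided estimate with a remainder of order `s > 1`, then the functionals in the duality map at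
`x` are determined at `y`, because they give subgradients. -/
lemma rpow_norm_mul_apply_eq_of_mem_dualityMap {s q M R : ℝ} (hs : 1 < s) (hq : 1 ≤ q) (hR : 0 < R)
    {x : X} {f : StrongDual ℝ X} (hf : f ∈ dualityMap s x) {A : X → ℝ}
    (hA : ∀ (c : ℝ) y, A (c • y) = c * A y)
    (hM : ∀ y, ‖y‖ ≤ R → ‖x - y‖ ^ q ≤ ‖x‖ ^ q - q * A y + M * ‖y‖ ^ s) (y : X) :
    ‖x‖ ^ (q - s) * f y = A y := by
  have main : ∀ y, A y ≤ ‖x‖ ^ (q - s) * f y := by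
    intro y
    have key : ∀ᶠ δ in nhdsWithin (0 : ℝ) (Ioi 0),
        q * (A y - ‖x‖ ^ (q - s) * f y) ≤ M * ‖y‖ ^ s * δ ^ (s - 1) := by
      have h1 : ∀ᶠ δ : ℝ in nhdsWithin (0 : ℝ) (Ioi 0), δ * ‖y‖ < R := by
        have : Filter.Tendsto (fun δ : ℝ => δ * ‖y‖) (nhds 0) (nhds 0) := by
          simpa using (continuous_id.mul_const ‖y‖).tendsto (0 : ℝ)
        exact (this.mono_left nhdsWithin_le_nhds).eventually_lt_const hR
      filter_upwards [h1, self_mem_nhdsWithin] with δ hδR hδ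
      have hδ0 : 0 < δ := hδ
      have hn : ‖δ • y‖ = δ * ‖y‖ := by rw [norm_smul, Real.norm_of_nonneg hδ0.le]
      have h2 := hM (δ • y) (by rw [hn]; exact hδR.le)
      have h3 := rpow_norm_sub_mul_le_rpow_norm_sub hs hq hf (δ • y)
      rw [hA, hn, Real.mul_rpow hδ0.le (norm_nonneg _)] at h2
      rw [map_smul, smul_eq_mul] at h3
      have e : δ ^ s = δ ^ (s - 1) * δ := by
        rw [← Real.rpow_add_one hδ0.ne', sub_add_cancel]
      rw [e] at h2
      refine le_of_mul_le_mul_right ?_ hδ0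
      linarith
    have hlim : Filter.Tendsto (fun δ : ℝ => M * ‖y‖ ^ s * δ ^ (s - 1)) (nhdsWithin 0 (Ioi 0))
        (nhds (M * ‖y‖ ^ s * 0 ^ (s - 1))) :=
      (((Real.continuousAt_rpow_const 0 (s - 1) (Or.inr (by linarith))).const_mul
        (M * ‖y‖ ^ s)).tendsto).mono_left nhdsWithin_le_nhds
    rw [Real.zero_rpow (by linarith), mul_zero] at hlim
    have := ge_of_tendsto hlim key
    nlinarith
  refine le_antisymm ?_ (main y)
  have h := main ((-1 : ℝ) • y)
  rw [hA, map_smul, smul_eq_mul] at h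
  linarith

end NormedSpace

/-! ### Integration of the pointwise inequality -/

section Lp

variable {X : Type*} [NormedAddCommGroup X] {α : Type*} [MeasurableSpace α] {μ : Measure α}

lemma Lp_integrable_rpow_norm {q : ℝ} (hq : 0 < q) (u : Lp X (ENNReal.ofReal q) μ) :
    Integrable (fun t => ‖u t‖ ^ q) μ := by
  have := (Lp.memLp u).integrable_norm_rpow (by simpa using hq) ENNReal.ofReal_ne_top
  rwa [ENNReal.toReal_ofReal hq.le] at this

lemma Lp_rpow_norm_eq_integral {q : ℝ} (hq : 0 < q) (u : Lp X (ENNReal.ofReal q) μ) :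
    ‖u‖ ^ q = ∫ t, ‖u t‖ ^ q ∂μ := by
  have hnn : 0 ≤ ∫ t, ‖u t‖ ^ q ∂μ := integral_nonneg fun t => by positivity
  rw [Lp.norm_def, (Lp.memLp u).eLpNorm_eq_integral_rpow_norm (by simpa using hq)
    ENNReal.ofReal_ne_top, ENNReal.toReal_ofReal hq.le, ENNReal.toReal_ofReal (by positivity),
    ← Real.rpow_mul hnn, inv_mul_cancel₀ hq.ne', Real.rpow_one]

variable [NormedSpace ℝ X]

/-- A selection of the duality map of a `p`-smooth space is weakly measurable along measurable
functions, because its values are limits of difference quotients of `‖·‖ ^ p`. -/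
lemma aestronglyMeasurable_dualityMap_apply {p G : ℝ} (hp : 1 < p)
    (hX : IsSmoothOfPowerTypeWith X p G) {j : X → StrongDual ℝ X}
    (hj : ∀ x, j x ∈ dualityMap p x) {u v : α → X} (hu : AEStronglyMeasurable u μ)
    (hv : AEStronglyMeasurable v μ) : AEStronglyMeasurable (fun t => j (u t) (v t)) μ := by
  have hp0 : 0 < p := by linarith
  let δ : ℕ → ℝ := fun n => 1 / ((n : ℝ) + 1)
  have hδ0 : ∀ n, 0 < δ n := fun n => by positivity
  have hδ : Filter.Tendsto δ Filter.atTop (nhds 0) := tendsto_one_div_add_atTop_nhds_zero_nat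
  refine aestronglyMeasurable_of_tendsto_ae Filter.atTop
    (f := fun n t => (‖u t‖ ^ p - ‖u t - δ n • v t‖ ^ p) / (p * δ n)) (fun n => ?_)
    (Filter.Eventually.of_forall fun t => ?_)
  · have h1 := (hu.norm.aemeasurable.pow_const p)
    have h2 := ((hu.sub (hv.const_smul (δ n))).norm.aemeasurable.pow_const p)
    exact ((h1.sub h2).div_const _).aestronglyMeasurable
  · have hlim : Filter.Tendsto (fun n => j (u t) (v t) - G * ‖v t‖ ^ p / p * δ n ^ (p - 1))
        Filter.atTop (nhds (j (u t) (v t))) := by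
      have h := (((Real.continuousAt_rpow_const 0 (p - 1) (Or.inr (by linarith))).tendsto.comp
        hδ).const_mul (G * ‖v t‖ ^ p / p)).const_sub (j (u t) (v t))
      simpa [Real.zero_rpow (by linarith : p - 1 ≠ 0)] using h
    refine tendsto_of_tendsto_of_tendsto_of_le_of_le hlim tendsto_const_nhds (fun n => ?_)
      (fun n => ?_)
    · have h := hX.2 (u t) _ (hj (u t)) (δ n • v t)
      rw [map_smul, norm_smul, Real.norm_of_nonneg (hδ0 n).le,
        Real.mul_rpow (hδ0 n).le (norm_nonneg _), smul_eq_mul] at h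
      have e : δ n ^ p = δ n ^ (p - 1) * δ n := by
        rw [← Real.rpow_add_one (hδ0 n).ne', sub_add_cancel]
      rw [e] at h
      rw [le_div_iff₀ (mul_pos hp0 (hδ0 n))]
      have e2 : (j (u t) (v t) - G * ‖v t‖ ^ p / p * δ n ^ (p - 1)) * (p * δ n) =
          p * (δ n * j (u t) (v t)) - G * (δ n ^ (p - 1) * δ n * ‖v t‖ ^ p) := by
        field_simp
      rw [e2]
      linarith
    · have h := rpow_norm_sub_mul_le_rpow_norm_sub hp hp.le (hj (u t)) (δ n • v t)
      rw [sub_self, Real.rpow_zero, one_mul, map_smul, smul_eq_mul] at h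
      rw [div_le_iff₀ (mul_pos hp0 (hδ0 n))]
      linarith

/-- The pairing `⟨j_q(u), v⟩` in `L^q`, where `j_q(x) = ‖x‖ ^ (q - p) j_p(x)`, is integrable. -/
lemma integrable_dualityMap_apply {p q G : ℝ} (hp : 1 < p) (hq : 1 < q)
    (hX : IsSmoothOfPowerTypeWith X p G) {j : X → StrongDual ℝ X}
    (hj : ∀ x, j x ∈ dualityMap p x) (u v : Lp X (ENNReal.ofReal q) μ) :
    Integrable (fun t => ‖u t‖ ^ (q - p) * j (u t) (v t)) μ := by
  have hq0 : 0 < q := by linarith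
  refine ((Lp_integrable_rpow_norm hq0 u).add (Lp_integrable_rpow_norm hq0 v)).mono' ?_
    (Filter.Eventually.of_forall fun t => ?_)
  · have h1 := (Lp.aestronglyMeasurable u).norm.aemeasurable.pow_const (q - p)
    exact h1.aestronglyMeasurable.mul (aestronglyMeasurable_dualityMap_apply hp hX hj
      (Lp.aestronglyMeasurable u) (Lp.aestronglyMeasurable v))
  · simp only [Pi.add_apply]
    rcases eq_or_ne (u t) 0 with h0 | h0
    · rw [h0, eq_zero_of_mem_dualityMap_zero hp (hj 0)]
      simp
      positivity
    · have hn : 0 < ‖u t‖ := norm_pos_iff.2 h0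
      have h1 : ‖j (u t) (v t)‖ ≤ ‖u t‖ ^ (p - 1) * ‖v t‖ :=
        (hj (u t)).2 ▸ (j (u t)).le_opNorm (v t)
      have h2 : ‖‖u t‖ ^ (q - p) * j (u t) (v t)‖ ≤ ‖u t‖ ^ (q - 1) * ‖v t‖ := by
        rw [norm_mul, Real.norm_of_nonneg (by positivity)]
        refine (mul_le_mul_of_nonneg_left h1 (by positivity)).trans_eq ?_
        rw [← mul_assoc, ← Real.rpow_add hn]
        congr 2; ring
      refine h2.trans ?_
      have e : ∀ a : ℝ, 0 ≤ a → a ^ (q - 1) * a = a ^ q := fun a ha => by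
        conv_lhs => rw [← Real.rpow_one a, ← Real.rpow_mul ha, one_mul]
        rw [← Real.rpow_add_of_nonneg ha (by linarith) zero_le_one, sub_add_cancel]
      -- `a ^ (q - 1) * b ≤ max a b ^ q ≤ a ^ q + b ^ q`
      rcases le_total ‖u t‖ ‖v t‖ with h | h
      · calc ‖u t‖ ^ (q - 1) * ‖v t‖ ≤ ‖v t‖ ^ (q - 1) * ‖v t‖ := by gcongr
          _ = ‖v t‖ ^ q := e _ (norm_nonneg _)
          _ ≤ _ := le_add_of_nonneg_left (by positivity)
      · calc ‖u t‖ ^ (q - 1) * ‖v t‖ ≤ ‖u t‖ ^ (q - 1) * ‖u t‖ := by gcongr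
          _ = ‖u t‖ ^ q := e _ (norm_nonneg _)
          _ ≤ _ := le_add_of_nonneg_right (by positivity)

lemma integral_dualityMap_apply_smul {p q : ℝ} (j : X → StrongDual ℝ X)
    (u : Lp X (ENNReal.ofReal q) μ) (c : ℝ) (v : Lp X (ENNReal.ofReal q) μ) :
    ∫ t, ‖u t‖ ^ (q - p) * j (u t) ((c • v : Lp X (ENNReal.ofReal q) μ) t) ∂μ =
      c * ∫ t, ‖u t‖ ^ (q - p) * j (u t) (v t) ∂μ := by
  rw [← integral_const_mul]
  refine integral_congr_ae ?_
  filter_upwards [Lp.coeFn_smul c v] with t ht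
  rw [ht, Pi.smul_apply, map_smul, smul_eq_mul]
  ring

/-- Integrated form of a pointwise inequality for `‖x - y‖ ^ q`. -/
lemma Lp_rpow_norm_sub_le_of_pointwise {p q G W₁ W₂ : ℝ} (hp : 1 < p) (hq : 1 < q)
    (hX : IsSmoothOfPowerTypeWith X p G) {j : X → StrongDual ℝ X}
    (hj : ∀ x, j x ∈ dualityMap p x) (u v : Lp X (ENNReal.ofReal q) μ)
    (H : ∀ x y : X, ‖x - y‖ ^ q ≤
      ‖x‖ ^ q - q * (‖x‖ ^ (q - p) * j x y) + (W₁ * ‖x‖ ^ q + W₂ * ‖y‖ ^ q)) :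
    ‖u - v‖ ^ q ≤ ‖u‖ ^ q - q * ∫ t, ‖u t‖ ^ (q - p) * j (u t) (v t) ∂μ +
      (W₁ * ‖u‖ ^ q + W₂ * ‖v‖ ^ q) := by
  have hq0 : 0 < q := by linarith
  have hu := Lp_integrable_rpow_norm hq0 u
  have hv := Lp_integrable_rpow_norm hq0 v
  have hd := (integrable_dualityMap_apply hp hq hX hj u v).const_mul q
  have hl : Integrable (fun t => ‖u t‖ ^ q - q * (‖u t‖ ^ (q - p) * j (u t) (v t))) μ := hu.sub hd
  have hr : Integrable (fun t => W₁ * ‖u t‖ ^ q + W₂ * ‖v t‖ ^ q) μ :=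
    (hu.const_mul W₁).add (hv.const_mul W₂)
  rw [Lp_rpow_norm_eq_integral hq0 u, Lp_rpow_norm_eq_integral hq0 v,
    Lp_rpow_norm_eq_integral hq0 (u - v), ← integral_const_mul, ← integral_const_mul,
    ← integral_const_mul, ← integral_sub hu hd,
    ← integral_add (hu.const_mul W₁) (hv.const_mul W₂),
    ← integral_add hl hr]
  refine integral_mono_ae (Lp_integrable_rpow_norm hq0 (u - v)) (hl.add hr) ?_
  filter_upwards [Lp.coeFn_sub u v] with t ht
  rw [ht]
  exact H (u t) (v t)

/-! ### Smoothness of the Lebesgue-Bochner space -/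

/-- For `q ≤ p` the pointwise inequality already has the form of `q`-smoothness, so that the
integrated one only needs the identification of the duality map. -/
theorem IsSmoothOfPowerTypeWith.Lp_of_le {p q G C : ℝ} [Fact (1 ≤ ENNReal.ofReal q)]
    (hq : 1 < q) (hqp : q ≤ p) (hX : IsSmoothOfPowerTypeWith X p G)
    (hC₁ : 2 ^ q ≤ C) (hC₂ : 2 ^ (p - q) * G ≤ C) :
    IsSmoothOfPowerTypeWith (Lp X (ENNReal.ofReal q) μ) q C := by
  have hp : 1 < p := by linarith
  have hC : 1 ≤ C := (Real.one_le_rpow one_le_two (by linarith)).trans hC₁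
  choose j hj using fun x : X => dualityMap_nonempty hp x
  refine ⟨by linarith, fun u f hf => ?_⟩
  have key : ∀ v : Lp X (ENNReal.ofReal q) μ, ‖u - v‖ ^ q ≤
      ‖u‖ ^ q - q * (∫ t, ‖u t‖ ^ (q - p) * j (u t) (v t) ∂μ) + C * ‖v‖ ^ q := by
    intro v
    have h := Lp_rpow_norm_sub_le_of_pointwise hp hq hX hj u v (W₁ := 0) (W₂ := C)
      fun x y => hX.rpow_norm_sub_le hp (by linarith) hC
        (fun h k b hh hk hu _ hb hs => by
          rw [zero_add]
          exact rpow_le_one_sub_mul_add_of_le hq hqp hX.1.le hC₁ hC₂ hh hk hu hb hs) x y (hj x)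
    rwa [zero_mul, zero_add] at h
  intro v
  have e := rpow_norm_mul_apply_eq_of_mem_dualityMap hq hq.le one_pos hf
    (A := fun v => ∫ t, ‖u t‖ ^ (q - p) * j (u t) (v t) ∂μ)
    (integral_dualityMap_apply_smul (p := p) j u) (fun v _ => key v) v
  rw [sub_self, Real.rpow_zero, one_mul] at e
  rw [e]
  exact key v

/-- For `p ≤ q` the constant is stated without Lipschitz constants; as `q` tends to `p`, both lower
bounds required of `C` become those of the case `q = p`. -/
theorem IsSmoothOfPowerTypeWith.Lp_of_ge {p q G C : ℝ} [Fact (1 ≤ ENNReal.ofReal q)]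
    (hp : 1 < p) (hp2 : p ≤ 2) (hpq : p ≤ q) (hX : IsSmoothOfPowerTypeWith X p G)
    (hC₁ : 2 ^ q + (q - p) * 2 ^ (q - 1) ≤ C)
    (hC₂ : G + (q - p) * (2 ^ (p - 1) + 2 ^ (q - 1)) ≤ C) :
    IsSmoothOfPowerTypeWith (Lp X (ENNReal.ofReal q) μ) p C := by
  have hp0 : 0 < p := by linarith
  have hq : 1 < q := by linarith
  have hq0 : 0 < q := by linarith
  have hCq : 2 ^ q ≤ C :=
    (le_add_of_nonneg_right (mul_nonneg (by linarith) (by positivity))).trans hC₁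
  have hC : 1 ≤ C := (Real.one_le_rpow one_le_two hq0.le).trans hCq
  -- for `‖v‖ ≥ R ‖u‖` the triangle inequality suffices
  obtain ⟨R, hR⟩ : ∃ R : ℝ, R = 2 ∧ q - p ≤ 1 ∨ R = 1 ∧ 1 ≤ q - p := by
    rcases le_total (q - p) 1 with h | h
    · exact ⟨2, Or.inl ⟨rfl, h⟩⟩
    · exact ⟨1, Or.inr ⟨rfl, h⟩⟩
  have hR0 : 0 < R := by rcases hR with ⟨rfl, _⟩ | ⟨rfl, _⟩ <;> norm_num
  have hR2 : R ≤ 2 := by rcases hR with ⟨rfl, _⟩ | ⟨rfl, _⟩ <;> norm_num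
  choose j hj using fun x : X => dualityMap_nonempty hp x
  refine ⟨by linarith, fun u f hf => ?_⟩
  rcases eq_or_ne u 0 with rfl | hu
  · intro v
    rw [eq_zero_of_mem_dualityMap_zero hp hf, zero_sub, norm_neg]
    simpa [Real.zero_rpow hp0.ne'] using
      le_mul_of_one_le_left (Real.rpow_nonneg (norm_nonneg v) p) hC
  have hN : 0 < ‖u‖ := norm_pos_iff.2 hu
  -- the integrated inequality, with the parameter `τ = ‖v‖ / ‖u‖`
  have key : ∀ v : Lp X (ENNReal.ofReal q) μ, ‖v‖ ≤ R * ‖u‖ → ‖u - v‖ ^ q ≤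
      ‖u‖ ^ q - q * (∫ t, ‖u t‖ ^ (q - p) * j (u t) (v t) ∂μ) +
        C * (q / p) * ‖u‖ ^ (q - p) * ‖v‖ ^ p := by
    intro v hv
    rcases eq_or_ne v 0 with rfl | hv0
    · have e : ∫ t, ‖u t‖ ^ (q - p) * j (u t) ((0 : Lp X (ENNReal.ofReal q) μ) t) ∂μ = 0 := by
        simpa using integral_dualityMap_apply_smul (p := p) j u 0 0
      rw [e]
      simp [Real.zero_rpow hp0.ne']
    · have hρ : 0 < ‖v‖ := norm_pos_iff.2 hv0
      set τ : ℝ := ‖v‖ / ‖u‖ with hτ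
      have hτ0 : 0 < τ := by positivity
      have hτR : τ ≤ R := (div_le_iff₀ hN).2 hv
      have hW : 1 ≤ C * τ ^ (p - q) := by
        have h1 : (2 : ℝ) ^ (p - q) ≤ τ ^ (p - q) :=
          Real.rpow_le_rpow_of_nonpos hτ0 (hτR.trans hR2) (by linarith)
        have h2 : (1 : ℝ) ≤ 2 ^ q * 2 ^ (p - q) := by
          rw [← Real.rpow_add two_pos, add_sub_cancel]
          exact Real.one_le_rpow one_le_two hp0.le
        exact h2.trans (by gcongr)
      have h := Lp_rpow_norm_sub_le_of_pointwise hp hq hX hj u v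
        (W₁ := C * ((q - p) / p * τ ^ p)) (W₂ := C * τ ^ (p - q))
        fun x y => hX.rpow_norm_sub_le hp hq0 hW
          (fun h k b hh hk hu hl hb hs => by
            rw [mul_assoc C, ← mul_add]
            exact rpow_le_one_sub_mul_add_of_ge hp hp2 hpq hR hC₁ hC₂ hτ0 hτR hh hk hu hl hb hs)
          x y (hj x)
      refine h.trans_eq ?_
      have e1 : τ ^ p = ‖v‖ ^ p / ‖u‖ ^ p := Real.div_rpow hρ.le hN.le p
      have e2 : τ ^ (p - q) = ‖v‖ ^ p / ‖v‖ ^ q * (‖u‖ ^ q / ‖u‖ ^ p) := by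
        rw [hτ, Real.div_rpow hρ.le hN.le, Real.rpow_sub hρ, Real.rpow_sub hN, div_div_eq_mul_div]
        field_simp
      have := Real.rpow_pos_of_pos hN p
      have := Real.rpow_pos_of_pos hN q
      have := Real.rpow_pos_of_pos hρ q
      rw [e1, e2, Real.rpow_sub hN]
      field_simp
      ring
  intro v
  have hNp : 0 < ‖u‖ ^ p := Real.rpow_pos_of_pos hN p
  rcases le_total ‖v‖ (R * ‖u‖) with hv | hv
  · have e := rpow_norm_mul_apply_eq_of_mem_dualityMap hp hq.le (mul_pos hR0 hN) hf
      (A := fun v => ∫ t, ‖u t‖ ^ (q - p) * j (u t) (v t) ∂μ)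
      (integral_dualityMap_apply_smul (p := p) j u) key v
    have h1 := key v hv
    rw [← e] at h1
    have hE : 0 < ‖u‖ ^ (q - p) := Real.rpow_pos_of_pos hN _
    have eq1 : ‖u‖ ^ q = ‖u‖ ^ (q - p) * ‖u‖ ^ p := by
      rw [← Real.rpow_add hN, sub_add_cancel]
    -- Bernoulli's inequality passes from the exponent `q` to `p`, rescaled by `‖u‖`
    have h2 := one_add_mul_rpow_sub_one_le_rpow hp0 hpq
      (div_nonneg (norm_nonneg (u - v)) hN.le)
    rw [Real.div_rpow (norm_nonneg _) hN.le, Real.div_rpow (norm_nonneg _) hN.le,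
      le_div_iff₀ (Real.rpow_pos_of_pos hN q), eq1] at h2
    rw [eq1] at h1
    have h3 : (1 + q / p * (‖u - v‖ ^ p / ‖u‖ ^ p - 1)) * (‖u‖ ^ (q - p) * ‖u‖ ^ p) =
        ‖u‖ ^ (q - p) * ‖u‖ ^ p + ‖u‖ ^ (q - p) * (q / p) * (‖u - v‖ ^ p - ‖u‖ ^ p) := by
      field_simp
    rw [h3] at h2
    have h4 : ‖u‖ ^ (q - p) * (q / p) * (‖u - v‖ ^ p - ‖u‖ ^ p) ≤
        ‖u‖ ^ (q - p) * (q / p) * (-(p * f v) + C * ‖v‖ ^ p) := by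
      have : ‖u‖ ^ (q - p) * (q / p) * (-(p * f v) + C * ‖v‖ ^ p) =
          -(q * (‖u‖ ^ (q - p) * f v)) + C * (q / p) * ‖u‖ ^ (q - p) * ‖v‖ ^ p := by
        field_simp
      linarith
    have h5 := le_of_mul_le_mul_left h4 (by positivity)
    linarith
  · have hr : R ≤ ‖v‖ / ‖u‖ := (le_div_iff₀ hN).2 hv
    have h1 := one_add_rpow_add_mul_le_one_add_mul_rpow hp hp2 hpq hR hCq hr
    have h2 := apply_le_of_mem_dualityMap hf v
    have h3 : ‖u - v‖ ^ p ≤ (‖u‖ + ‖v‖) ^ p := by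
      gcongr
      exact norm_sub_le u v
    have h4 : 1 + ‖v‖ / ‖u‖ = (‖u‖ + ‖v‖) / ‖u‖ := by field_simp
    rw [h4, Real.div_rpow (by positivity) hN.le, Real.div_rpow (norm_nonneg _) hN.le] at h1
    have h5 := mul_le_mul_of_nonneg_right h1 hNp.le
    rw [Real.rpow_sub_one hN.ne'] at h2
    have e1 : ((‖u‖ + ‖v‖) ^ p / ‖u‖ ^ p + p * (‖v‖ / ‖u‖)) * ‖u‖ ^ p =
        (‖u‖ + ‖v‖) ^ p + p * (‖u‖ ^ p / ‖u‖ * ‖v‖) := by field_simp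
    have e2 : (1 + C * (‖v‖ ^ p / ‖u‖ ^ p)) * ‖u‖ ^ p = ‖u‖ ^ p + C * ‖v‖ ^ p := by field_simp
    rw [e1, e2] at h5
    have h6 := mul_le_mul_of_nonneg_left h2 hp0.le
    linarith

end Lp

lemma IsSmoothOfPowerTypeWith.of_subsingleton {X : Type*} [NormedAddCommGroup X] [NormedSpace ℝ X]
    [Subsingleton X] {s C : ℝ} (hs : s ≠ 0) (hC : 0 < C) : IsSmoothOfPowerTypeWith X s C := by
  refine ⟨hC, fun x f _ y => ?_⟩
  rw [Subsingleton.elim x 0, Subsingleton.elim y 0]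
  simp [Real.zero_rpow hs]

theorem mainTheorem1 {X : Type*} [NormedAddCommGroup X] [NormedSpace ℝ X] [CompleteSpace X]
    (p q T G : ℝ) [Fact (1 ≤ ENNReal.ofReal q)] (hp : 1 < p) (hq : 1 < q) (hT : 0 < T)
    (hX : IsSmoothOfPowerTypeWith X p G) :
    IsSmoothOfPowerType (LebesgueBochner q T X) (min p q) ∧
    (q ≤ p → IsSmoothOfPowerTypeWith (LebesgueBochner q T X) q
      ((2 : ℝ) ^ (p - q) *
        max ((2 : ℝ) ^ p) (G + (powLipschitzConst (q - p) : ℝ) * (2 : ℝ) ^ (p - 2)))) ∧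
    (p ≤ q → IsSmoothOfPowerTypeWith (LebesgueBochner q T X) p
      (max ((2 : ℝ) ^ q)
          ((2 : ℝ) ^ (q - p) * G + (powLipschitzConst (q - p) : ℝ) * (2 : ℝ) ^ (q - 2)) +
        (powLipschitzConst (p - q) : ℝ) * (2 : ℝ) ^ (p - 2))) := by
  have case₁ : q ≤ p → IsSmoothOfPowerTypeWith (LebesgueBochner q T X) q
      ((2 : ℝ) ^ (p - q) *
        max ((2 : ℝ) ^ p) (G + (powLipschitzConst (q - p) : ℝ) * (2 : ℝ) ^ (p - 2))) := by
    intro hqp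
    have h1 : (1 : ℝ) ≤ 2 ^ (p - q) := Real.one_le_rpow one_le_two (by linarith)
    have h2 : (2 : ℝ) ^ q ≤ 2 ^ p := Real.rpow_le_rpow_of_exponent_le one_le_two hqp
    refine hX.Lp_of_le hq hqp ?_ ?_
    · calc (2 : ℝ) ^ q ≤ 1 * 2 ^ p := by rwa [one_mul]
        _ ≤ _ := by gcongr; exact le_max_left _ _
    · gcongr
      exact le_max_of_le_right (le_add_of_nonneg_right (by positivity))
  have case₂ : p ≤ q → IsSmoothOfPowerTypeWith (LebesgueBochner q T X) p
      (max ((2 : ℝ) ^ q)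
          ((2 : ℝ) ^ (q - p) * G + (powLipschitzConst (q - p) : ℝ) * (2 : ℝ) ^ (q - 2)) +
        (powLipschitzConst (p - q) : ℝ) * (2 : ℝ) ^ (p - 2)) := by
    intro hpq
    rcases subsingleton_or_nontrivial X with hS | hS
    · have : Subsingleton (LebesgueBochner q T X) :=
        ⟨fun u v => Lp.ext (Filter.Eventually.of_forall fun t => Subsingleton.elim _ _)⟩
      exact IsSmoothOfPowerTypeWith.of_subsingleton (by linarith)
        (add_pos_of_pos_of_nonneg (lt_max_of_lt_left (by positivity)) (by positivity))
    · have hK : (q - p) * 2 ^ (p - 1) ≤ (powLipschitzConst (q - p) : ℝ) * 2 ^ (q - 2) := by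
        refine le_trans (le_of_eq ?_) (mul_le_mul_of_nonneg_right
          (abs_mul_rpow_le_powLipschitzConst (q - p)) (by positivity))
        rw [abs_of_nonneg (by linarith), one_div, Real.inv_rpow two_pos.le,
          ← Real.rpow_neg two_pos.le, mul_assoc, ← Real.rpow_add two_pos]
        congr 2; ring
      have hK' : (q - p) * 2 ^ (q - 1) ≤ (powLipschitzConst (p - q) : ℝ) * 2 ^ (p - 2) := by
        refine le_trans (le_of_eq ?_) (mul_le_mul_of_nonneg_right
          (abs_mul_rpow_le_powLipschitzConst (p - q)) (by positivity))
        rw [abs_of_nonpos (by linarith), one_div, Real.inv_rpow two_pos.le,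
          ← Real.rpow_neg two_pos.le, mul_assoc, ← Real.rpow_add two_pos, neg_sub]
        congr 2; ring
      have hG : G ≤ 2 ^ (q - p) * G :=
        le_mul_of_one_le_left hX.1.le (Real.one_le_rpow one_le_two (by linarith))
      refine hX.Lp_of_ge hp (hX.le_two hp) hpq ?_ ?_
      · exact add_le_add (le_max_left _ _) hK'
      · rw [mul_add, ← add_assoc]
        exact add_le_add (le_max_of_le_right (add_le_add hG hK)) hK'
  refine ⟨?_, case₁, case₂⟩
  rcases le_total q p with h | h
  · rw [min_eq_right h]
    exact ⟨_, case₁ h⟩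
  · rw [min_eq_left h]
    exact ⟨_, case₂ h⟩
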